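/- For a finite linear hyperplane arrangement $\mathcal A$ in $\mathbb R^n$, let $\mathcal L[\mathcal A]$ be the set of its flats (all intersections of hyperplanes of $\mathcal A$, including the empty intersection $\mathbb R^n$), ordered by inclusion, with minimum element $\bot=\bigcap\mathcal A$ and Möbius function $\mu$. The Primitive Eulerian polynomial of $\mathcal A$ is $$P_{\mathcal A}(z)=\sum_{X\in\mathcal L[\mathcal A]}|\mu(\bot,X)|\,(z-1)^{\operatorname{codim}(X)}.$$ Let $\mathcal A_n$ be the braid arrangement in $\mathbb R^n$, consisting of the hyperplanes $x_i=x_j$ for $1\le i<j\le n$, and let $\mathcal B_n$ be the type B Coxeter arrangement in $\mathbb R^n$, consisting of the hyperplanes $x_i=x_j$ and $x_i=-x_j$ for $1\le i<j\le n$ and $x_i=0$ for $1\le i\le n$. **Theorem.** $P_{\mathcal B_0}(z)=1$, and for all $n\ge 1$, $$P_{\mathcal B_n}(z)=z\,P_{\mathcal B_{n-1}}(z)+\sum_{k=1}^{n-1}\binom{n-1}{k}2^k\,P_{\mathcal B_{n-1-k}}(z)\,P_{\mathcal A_{k+1}}(z).$$ -/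

import Mathlib

open Polynomial

section Arrangements

variable {V : Type*} [AddCommGroup V] [Module ℝ V]

open Classical in
/-- The flats of a finite collection `A` of linear hyperplanes of `V`: all intersections of
subsets of `A`; the empty intersection is `V` itself. -/
noncomputable def arrFlats (A : Finset (Submodule ℝ V)) : Finset (Submodule ℝ V) :=
  A.powerset.image fun S => S.inf id

theorem inf_mem_arrFlats (A : Finset (Submodule ℝ V)) : A.inf id ∈ arrFlats A := by
  classical
  exact Finset.mem_image.2 ⟨A, Finset.mem_powerset_self A, rfl⟩

/-- The minimum flat: the intersection of all the hyperplanes of `A`. -/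
noncomputable def botFlat (A : Finset (Submodule ℝ V)) : arrFlats A :=
  ⟨A.inf id, inf_mem_arrFlats A⟩

open Classical in
/-- The set of flats, ordered by inclusion, is a finite poset. -/
noncomputable instance arrFlatsLocallyFinite (A : Finset (Submodule ℝ V)) :
    LocallyFiniteOrder (arrFlats A) :=
  Fintype.toLocallyFiniteOrder

open Classical in
/-- The value `μ(X, Y)` of the Möbius function of the poset of flats of `A`. -/
noncomputable def flatMu (A : Finset (Submodule ℝ V)) (X Y : arrFlats A) : ℤ :=
  IncidenceAlgebra.mu ℤ X Y

/-- The Primitive Eulerian polynomial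
`P_A(z) = ∑_X |μ(⊥, X)| (z - 1) ^ codim X`, the sum being over all flats `X` of `A`. The
codimension of `X` is the dimension of the quotient `V ⧸ X`. -/
noncomputable def primitiveEulerian (A : Finset (Submodule ℝ V)) : ℤ[X] :=
  ∑ Y : arrFlats A,
    C |flatMu A (botFlat A) Y| * (X - 1) ^ Module.finrank ℝ (V ⧸ (Y : Submodule ℝ V))

end Arrangements

/-- The hyperplane `x i = x j` of `ℝⁿ` (for `i ≠ j`). -/
def hypEq {n : ℕ} (i j : Fin n) : Submodule ℝ (Fin n → ℝ) where
  carrier := {x | x i = x j}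
  add_mem' := fun {a b} (ha : a i = a j) (hb : b i = b j) => by
    simp [ha, hb]
  zero_mem' := rfl
  smul_mem' := fun c x (hx : x i = x j) => by simp [hx]

/-- The hyperplane `x i = - x j` of `ℝⁿ` (for `i ≠ j`). -/
def hypNeg {n : ℕ} (i j : Fin n) : Submodule ℝ (Fin n → ℝ) where
  carrier := {x | x i = - x j}
  add_mem' := fun {a b} (ha : a i = - a j) (hb : b i = - b j) => by
    simp [ha, hb, add_comm]
  zero_mem' := by simp
  smul_mem' := fun c x (hx : x i = - x j) => by simp [hx]

/-- The coordinate hyperplane `x i = 0` of `ℝⁿ`. -/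
def hypZero {n : ℕ} (i : Fin n) : Submodule ℝ (Fin n → ℝ) where
  carrier := {x | x i = 0}
  add_mem' := fun {a b} (ha : a i = 0) (hb : b i = 0) => by
    simp [ha, hb]
  zero_mem' := rfl
  smul_mem' := fun c x (hx : x i = 0) => by simp [hx]

/-- The pairs `(i, j)` with `i < j`. -/
def ltPairs (n : ℕ) : Finset (Fin n × Fin n) :=
  Finset.univ.filter fun p => p.1 < p.2

open Classical in
/-- The braid arrangement in `ℝⁿ`: the hyperplanes `x i = x j` for `i < j`. -/
noncomputable def braidArr (n : ℕ) : Finset (Submodule ℝ (Fin n → ℝ)) :=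
  (ltPairs n).image fun p => hypEq p.1 p.2

open Classical in
/-- The type B Coxeter arrangement in `ℝⁿ`: the hyperplanes `x i = x j` and `x i = - x j` for
`i < j`, and `x i = 0` for all `i`. -/
noncomputable def typeBArr (n : ℕ) : Finset (Submodule ℝ (Fin n → ℝ)) :=
  (ltPairs n).image (fun p => hypEq p.1 p.2) ∪
    ((ltPairs n).image (fun p => hypNeg p.1 p.2) ∪ Finset.univ.image hypZero)

/-! ### Flats and the Möbius recursion. -/

section Flats

variable {V : Type*} [AddCommGroup V] [Module ℝ V] {A : Finset (Submodule ℝ V)}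

/-! Both families are built one coordinate at a time: the next arrangement consists of the cylinders
over the old hyperplanes and the graphs x₀ = φ of a set T of functionals (the coordinates for braid;
these, their negatives and 0 for type B). Differences of functionals in T vanish on old hyperplanes,
so every flat is a cylinder or a graph over an old flat. T has c(d) distinct restrictions to a flat
of dimension d, with c(d) = d for braid and 2d + 1 for type B. Hence μ(⊥, Y) depends only on d = dim
Y and satisfies f(d+1) = -c(d) f(d) (`IsFiberData.extend`).

Put t = z - 1 and weight the flats of dimension d by |f(d)| t^(n-d) u(d). Adding a coordinate
replaces u(d) by c(d)(t u(d) + u(d+1)) (`IsFiberData.flatSum_extArr`). For u(d) = Y^(2d+1) in type B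
and, up to a factor 2, u(d) = Y^(2d) in the braid case, this is the derivation D with D Y = Y(t +
Y²). So at Y = 1 the polynomial of B_n is Dⁿ Y, and 2ⁿ times that of A_{n+1} is Dⁿ Y². The
recurrence is Leibniz's rule for D^(n-1) applied to D Y = tY + Y·Y². -/

theorem top_mem_arrFlats (A : Finset (Submodule ℝ V)) : ⊤ ∈ arrFlats A := by
  classical
  exact Finset.mem_image.2 ⟨∅, Finset.empty_mem_powerset A, rfl⟩

theorem mem_arrFlats_of_mem {H : Submodule ℝ V} (h : H ∈ A) : H ∈ arrFlats A := by
  classical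
  exact Finset.mem_image.2 ⟨{H}, by simpa using h, by simp⟩

theorem inf_mem_arrFlats_of_mem {Y Z : Submodule ℝ V} (hY : Y ∈ arrFlats A)
    (hZ : Z ∈ arrFlats A) : Y ⊓ Z ∈ arrFlats A := by
  classical
  obtain ⟨S, hS, rfl⟩ := Finset.mem_image.1 hY
  obtain ⟨S', hS', rfl⟩ := Finset.mem_image.1 hZ
  rw [Finset.mem_powerset] at hS hS'
  exact Finset.mem_image.2 ⟨S ∪ S', Finset.mem_powerset.2 (Finset.union_subset hS hS'),
    Finset.inf_union⟩

theorem arrFlats_induction {p : Submodule ℝ V → Prop} (top : p ⊤)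
    (inf : ∀ Y, p Y → ∀ H ∈ A, p (Y ⊓ H)) {Y : Submodule ℝ V} (hY : Y ∈ arrFlats A) : p Y := by
  classical
  obtain ⟨S, hS, rfl⟩ := Finset.mem_image.1 hY
  rw [Finset.mem_powerset] at hS
  clear hY
  induction S using Finset.induction_on with
  | empty => exact top
  | insert H S _ ih =>
    rw [Finset.inf_insert, inf_comm]
    exact inf _ (ih ((Finset.subset_insert _ _).trans hS)) H
      (hS (Finset.mem_insert_self _ _))

theorem inf_le_of_mem_arrFlats {Y : Submodule ℝ V} (hY : Y ∈ arrFlats A) : A.inf id ≤ Y :=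
  arrFlats_induction (p := fun Y => A.inf id ≤ Y) le_top
    (fun _ h _ hH => le_inf h (Finset.inf_le (f := id) hH)) hY

open Classical in
/-- The defining recursion of the function `μ(⊥, ·)` determines it. -/
theorem flatMu_botFlat_eq {f : Submodule ℝ V → ℤ}
    (hf : ∀ Y ∈ arrFlats A,
      ∑ Z ∈ arrFlats A with Z ≤ Y, f Z = if Y = A.inf id then 1 else 0)
    (Y : arrFlats A) : flatMu A (botFlat A) Y = f Y := by
  have key : ∀ (g : Submodule ℝ V → ℤ) (Y : arrFlats A),
      ∑ Z ∈ (arrFlats A).filter fun Z => Z ≤ (Y : Submodule ℝ V), g Z =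
        ∑ Z ∈ Finset.Icc (botFlat A) Y, g Z := by
    intro g Y
    symm
    refine Finset.sum_bij (fun (Z : arrFlats A) _ => (Z : Submodule ℝ V)) ?_ ?_ ?_ ?_
    · intro Z hZ
      exact Finset.mem_filter.2 ⟨Z.2, (Finset.mem_Icc.1 hZ).2⟩
    · intro Z _ Z' _ h
      exact Subtype.ext h
    · intro Z hZ
      obtain ⟨hZ, hle⟩ := Finset.mem_filter.1 hZ
      exact ⟨⟨Z, hZ⟩, Finset.mem_Icc.2 ⟨inf_le_of_mem_arrFlats hZ, hle⟩, rfl⟩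
    · intros; rfl
  induction Y using WellFoundedLT.induction with
  | ind Y ih =>
    have hle : botFlat A ≤ Y := inf_le_of_mem_arrFlats Y.2
    have h1 := hf Y Y.2
    rw [key] at h1
    have h2 := IncidenceAlgebra.sum_Icc_mu_right (𝕜 := ℤ) (botFlat A) Y
    -- Isolate the term at `Y` in both recursions; the remaining sums agree by induction.
    rw [← Finset.Ico_insert_right hle, Finset.sum_insert Finset.right_notMem_Ico] at h1 h2
    have h3 : ∑ Z ∈ Finset.Ico (botFlat A) Y, IncidenceAlgebra.mu ℤ (botFlat A) Z
        = ∑ Z ∈ Finset.Ico (botFlat A) Y, f Z :=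
      Finset.sum_congr rfl fun Z hZ => ih Z (Finset.mem_Ico.1 hZ).2
    have h4 : (if botFlat A = Y then (1 : ℤ) else 0) =
        if (Y : Submodule ℝ V) = A.inf id then 1 else 0 := by
      refine if_congr ⟨fun h => ?_, fun h => ?_⟩ rfl rfl
      · rw [← h]; rfl
      · exact Subtype.ext h.symm
    unfold flatMu
    rw [h3, h4, ← h1] at h2
    exact add_right_cancel h2

theorem primitiveEulerian_eq_sum {f : Submodule ℝ V → ℤ}
    (hf : ∀ Y : arrFlats A, flatMu A (botFlat A) Y = f Y) :
    primitiveEulerian A =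
      ∑ Y ∈ arrFlats A, C |f Y| * (X - 1) ^ Module.finrank ℝ (V ⧸ Y) := by
  rw [primitiveEulerian, ← Finset.sum_coe_sort (arrFlats A)]
  exact Finset.sum_congr rfl fun Y _ => by rw [hf Y]

end Flats

/-! ### Adding a coordinate: cylinders and graphs. -/

section Extension

variable {n : ℕ}

/-- The projection `ℝⁿ⁺¹ → ℝⁿ` that forgets the coordinate `0`. -/
noncomputable abbrev tailMap (n : ℕ) : (Fin (n + 1) → ℝ) →ₗ[ℝ] (Fin n → ℝ) :=
  LinearMap.funLeft ℝ ℝ Fin.succ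

/-- The graph of a functional on `ℝⁿ`, as a hyperplane of `ℝⁿ⁺¹`. -/
noncomputable def dualGraph (φ : (Fin n → ℝ) →ₗ[ℝ] ℝ) : Submodule ℝ (Fin (n + 1) → ℝ) :=
  LinearMap.ker (LinearMap.proj 0 - φ ∘ₗ tailMap n)

theorem mem_dualGraph {φ : (Fin n → ℝ) →ₗ[ℝ] ℝ} {x : Fin (n + 1) → ℝ} :
    x ∈ dualGraph φ ↔ x 0 = φ (tailMap n x) := by
  simp [dualGraph, sub_eq_zero]

/-- The cylinder over a subspace of `ℝⁿ`. -/
noncomputable def cylinder (Y : Submodule ℝ (Fin n → ℝ)) : Submodule ℝ (Fin (n + 1) → ℝ) :=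
  Y.comap (tailMap n)

/-- The graph of a functional over a subspace of `ℝⁿ`. -/
noncomputable def graphOver (Y : Submodule ℝ (Fin n → ℝ)) (φ : (Fin n → ℝ) →ₗ[ℝ] ℝ) :
    Submodule ℝ (Fin (n + 1) → ℝ) :=
  cylinder Y ⊓ dualGraph φ

theorem mem_cylinder {Y : Submodule ℝ (Fin n → ℝ)} {x : Fin (n + 1) → ℝ} :
    x ∈ cylinder Y ↔ tailMap n x ∈ Y := Iff.rfl

theorem mem_graphOver {Y : Submodule ℝ (Fin n → ℝ)} {φ : (Fin n → ℝ) →ₗ[ℝ] ℝ}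
    {x : Fin (n + 1) → ℝ} :
    x ∈ graphOver Y φ ↔ tailMap n x ∈ Y ∧ x 0 = φ (tailMap n x) := by
  rw [graphOver, Submodule.mem_inf, mem_cylinder, mem_dualGraph]

theorem tailMap_cons (a : ℝ) (y : Fin n → ℝ) : tailMap n (Fin.cons a y) = y := by
  ext i
  simp [LinearMap.funLeft_apply]

theorem cons_mem_cylinder {Y : Submodule ℝ (Fin n → ℝ)} {a : ℝ} {y : Fin n → ℝ} :
    (Fin.cons a y : Fin (n + 1) → ℝ) ∈ cylinder Y ↔ y ∈ Y := by
  rw [mem_cylinder, tailMap_cons]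

theorem cons_mem_graphOver {Y : Submodule ℝ (Fin n → ℝ)} {φ : (Fin n → ℝ) →ₗ[ℝ] ℝ}
    {a : ℝ} {y : Fin n → ℝ} :
    (Fin.cons a y : Fin (n + 1) → ℝ) ∈ graphOver Y φ ↔ y ∈ Y ∧ a = φ y := by
  rw [mem_graphOver, tailMap_cons, Fin.cons_zero]

theorem cylinder_le_cylinder {Y Z : Submodule ℝ (Fin n → ℝ)} :
    cylinder Y ≤ cylinder Z ↔ Y ≤ Z := by
  refine ⟨fun h y hy => ?_, fun h => Submodule.comap_mono h⟩
  exact cons_mem_cylinder.1 (h (cons_mem_cylinder (a := 0).2 hy))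

theorem graphOver_le_cylinder {Y Z : Submodule ℝ (Fin n → ℝ)} {φ : (Fin n → ℝ) →ₗ[ℝ] ℝ} :
    graphOver Y φ ≤ cylinder Z ↔ Y ≤ Z := by
  refine ⟨fun h y hy => ?_, fun h => inf_le_left.trans (cylinder_le_cylinder.2 h)⟩
  exact cons_mem_cylinder.1 (h (cons_mem_graphOver.2 ⟨hy, rfl⟩))

theorem not_cylinder_le_graphOver (Y Z : Submodule ℝ (Fin n → ℝ))
    (φ : (Fin n → ℝ) →ₗ[ℝ] ℝ) : ¬ cylinder Y ≤ graphOver Z φ := fun h => by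
  -- The vector (1, 0, …, 0) lies in every cylinder and in no graph.
  have h1 := h (cons_mem_cylinder (a := 1) (y := 0).2 Y.zero_mem)
  simpa using (cons_mem_graphOver.1 h1).2

theorem graphOver_le_graphOver {Y Z : Submodule ℝ (Fin n → ℝ)}
    {φ ψ : (Fin n → ℝ) →ₗ[ℝ] ℝ} :
    graphOver Y φ ≤ graphOver Z ψ ↔ Y ≤ Z ∧ ∀ y ∈ Y, φ y = ψ y := by
  refine ⟨fun h => ⟨graphOver_le_cylinder.1 (h.trans inf_le_left), fun y hy => ?_⟩,
    fun h x hx => ?_⟩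
  · exact (cons_mem_graphOver.1 (h (cons_mem_graphOver.2 ⟨hy, rfl⟩))).2
  · rw [mem_graphOver] at hx ⊢
    exact ⟨h.1 hx.1, hx.2.trans (h.2 _ hx.1)⟩

theorem graphOver_eq_graphOver {Y Z : Submodule ℝ (Fin n → ℝ)}
    {φ ψ : (Fin n → ℝ) →ₗ[ℝ] ℝ} :
    graphOver Y φ = graphOver Z ψ ↔ Y = Z ∧ ∀ y ∈ Y, φ y = ψ y := by
  refine ⟨fun h => ?_, ?_⟩
  · have h1 := graphOver_le_graphOver.1 h.le
    exact ⟨le_antisymm h1.1 (graphOver_le_graphOver.1 h.ge).1, h1.2⟩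
  · rintro ⟨rfl, h⟩
    exact le_antisymm (graphOver_le_graphOver.2 ⟨le_rfl, h⟩)
      (graphOver_le_graphOver.2 ⟨le_rfl, fun y hy => (h y hy).symm⟩)

theorem map_cylinder (Y : Submodule ℝ (Fin n → ℝ)) : (cylinder Y).map (tailMap n) = Y := by
  ext y
  constructor
  · rintro ⟨x, hx, rfl⟩
    exact hx
  · exact fun hy => ⟨Fin.cons 0 y, cons_mem_cylinder.2 hy, tailMap_cons _ _⟩

theorem map_graphOver (Y : Submodule ℝ (Fin n → ℝ)) (φ : (Fin n → ℝ) →ₗ[ℝ] ℝ) :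
    (graphOver Y φ).map (tailMap n) = Y := by
  ext y
  constructor
  · rintro ⟨x, hx, rfl⟩
    exact (mem_graphOver.1 hx).1
  · exact fun hy => ⟨Fin.cons (φ y) y, cons_mem_graphOver.2 ⟨hy, rfl⟩, tailMap_cons _ _⟩

theorem finrank_graphOver (Y : Submodule ℝ (Fin n → ℝ)) (φ : (Fin n → ℝ) →ₗ[ℝ] ℝ) :
    Module.finrank ℝ (graphOver Y φ) = Module.finrank ℝ Y := by
  refine (LinearEquiv.finrank_eq (LinearEquiv.ofBijective
    (((LinearMap.pi (Fin.cons φ fun i => LinearMap.proj i)).comp Y.subtype).codRestrict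
      (graphOver Y φ) fun y => ?_) ⟨fun y z h => ?_, fun x => ?_⟩)).symm
  · rw [mem_graphOver]
    exact ⟨y.2, rfl⟩
  · ext i
    exact congrFun (congrArg Subtype.val h) i.succ
  · have hx := mem_graphOver.1 x.2
    refine ⟨⟨tailMap n x, hx.1⟩, Subtype.ext (funext fun i => ?_)⟩
    cases i using Fin.cases with
    | zero => exact hx.2.symm
    | succ i => rfl

theorem finrank_cylinder (Y : Submodule ℝ (Fin n → ℝ)) :
    Module.finrank ℝ (cylinder Y) = Module.finrank ℝ Y + 1 := by
  have e : (ℝ × Y) ≃ₗ[ℝ] cylinder Y := LinearEquiv.ofBijective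
    ((LinearMap.pi (Fin.cons (LinearMap.fst ℝ ℝ Y) fun i =>
      (LinearMap.proj i).comp (Y.subtype.comp (LinearMap.snd ℝ ℝ Y)))).codRestrict
      (cylinder Y) fun y => mem_cylinder.2 y.2.2) ⟨fun y z h => ?_, fun x => ?_⟩
  · rw [← e.finrank_eq, Module.finrank_prod, Module.finrank_self, add_comm]
  · refine Prod.ext (congrFun (congrArg Subtype.val h) 0) (Subtype.ext (funext fun i => ?_))
    exact congrFun (congrArg Subtype.val h) i.succ
  · refine ⟨(x.1 0, ⟨tailMap n x, x.2⟩), Subtype.ext (funext fun i => ?_)⟩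
    cases i using Fin.cases with
    | zero => rfl
    | succ i => rfl

open Classical in
/-- The arrangement in `ℝⁿ⁺¹` of the cylinders over the hyperplanes of `A` and the graphs of
the functionals in `T`. -/
noncomputable def extArr (A : Finset (Submodule ℝ (Fin n → ℝ)))
    (T : Finset ((Fin n → ℝ) →ₗ[ℝ] ℝ)) : Finset (Submodule ℝ (Fin (n + 1) → ℝ)) :=
  A.image cylinder ∪ T.image dualGraph

variable {A : Finset (Submodule ℝ (Fin n → ℝ))} {T : Finset ((Fin n → ℝ) →ₗ[ℝ] ℝ)}

theorem cylinder_mem_arrFlats {Y : Submodule ℝ (Fin n → ℝ)} (hY : Y ∈ arrFlats A) :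
    cylinder Y ∈ arrFlats (extArr A T) := by
  classical
  refine arrFlats_induction (p := fun Y => cylinder Y ∈ arrFlats (extArr A T))
    (top_mem_arrFlats _) (fun Y hY H hH => ?_) hY
  exact inf_mem_arrFlats_of_mem hY (mem_arrFlats_of_mem
    (Finset.mem_union_left _ (Finset.mem_image_of_mem _ hH)))

theorem graphOver_mem_arrFlats {Y : Submodule ℝ (Fin n → ℝ)} (hY : Y ∈ arrFlats A)
    {φ : (Fin n → ℝ) →ₗ[ℝ] ℝ} (hφ : φ ∈ T) : graphOver Y φ ∈ arrFlats (extArr A T) := by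
  classical
  exact inf_mem_arrFlats_of_mem (cylinder_mem_arrFlats hY) (mem_arrFlats_of_mem
    (Finset.mem_union_right _ (Finset.mem_image_of_mem _ hφ)))

/-- Intersect with one hyperplane at a time. The one case that needs `hT` is a graph of φ meeting a
graph of ψ ≠ φ: the new equation becomes φ = ψ on the base, which cuts the base by a hyperplane of
`A`. -/
theorem mem_arrFlats_extArr (hT : ∀ φ ∈ T, ∀ ψ ∈ T, φ ≠ ψ → LinearMap.ker (φ - ψ) ∈ A)
    {Z : Submodule ℝ (Fin (n + 1) → ℝ)} :
    Z ∈ arrFlats (extArr A T) ↔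
      ∃ Y ∈ arrFlats A, Z = cylinder Y ∨ ∃ φ ∈ T, Z = graphOver Y φ := by
  classical
  constructor
  · intro hZ
    refine arrFlats_induction (p := fun Z => ∃ Y ∈ arrFlats A, Z = cylinder Y ∨
      ∃ φ ∈ T, Z = graphOver Y φ) ⟨⊤, top_mem_arrFlats A, Or.inl rfl⟩ ?_ hZ
    rintro _ ⟨Y, hY, rfl | ⟨φ, hφ, rfl⟩⟩ H hH
    · rcases Finset.mem_union.1 hH with hH | hH
      · obtain ⟨H', hH', rfl⟩ := Finset.mem_image.1 hH
        exact ⟨Y ⊓ H', inf_mem_arrFlats_of_mem hY (mem_arrFlats_of_mem hH'), Or.inl rfl⟩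
      · obtain ⟨φ, hφ, rfl⟩ := Finset.mem_image.1 hH
        exact ⟨Y, hY, Or.inr ⟨φ, hφ, rfl⟩⟩
    · rcases Finset.mem_union.1 hH with hH | hH
      · obtain ⟨H', hH', rfl⟩ := Finset.mem_image.1 hH
        exact ⟨Y ⊓ H', inf_mem_arrFlats_of_mem hY (mem_arrFlats_of_mem hH'),
          Or.inr ⟨φ, hφ, inf_right_comm _ _ _⟩⟩
      · obtain ⟨ψ, hψ, rfl⟩ := Finset.mem_image.1 hH
        rcases eq_or_ne φ ψ with rfl | hne
        · exact ⟨Y, hY, Or.inr ⟨φ, hφ, by rw [graphOver, inf_assoc, inf_idem]⟩⟩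
        · refine ⟨_, inf_mem_arrFlats_of_mem hY (mem_arrFlats_of_mem (hT φ hφ ψ hψ hne)),
            Or.inr ⟨φ, hφ, ?_⟩⟩
          ext x
          simp only [Submodule.mem_inf, mem_graphOver, mem_dualGraph, LinearMap.mem_ker,
            LinearMap.sub_apply, sub_eq_zero]
          constructor
          · rintro ⟨⟨h1, h2⟩, h3⟩
            exact ⟨⟨h1, h2.symm.trans h3⟩, h2⟩
          · rintro ⟨⟨h1, h2⟩, h3⟩
            exact ⟨⟨h1, h3⟩, h3.trans h2⟩
  · rintro ⟨Y, hY, rfl | ⟨φ, hφ, rfl⟩⟩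
    · exact cylinder_mem_arrFlats hY
    · exact graphOver_mem_arrFlats hY hφ

-- Forgetting the coordinate 0 sends a flat to its base, so the flats are partitioned by base. The
-- inner sum runs over an image because functionals that agree on `Y` give the same flat.
open Classical in
theorem sum_arrFlats_extArr {M : Type*} [AddCommMonoid M]
    (hT : ∀ φ ∈ T, ∀ ψ ∈ T, φ ≠ ψ → LinearMap.ker (φ - ψ) ∈ A)
    (g : Submodule ℝ (Fin (n + 1) → ℝ) → M) :
    ∑ Z ∈ arrFlats (extArr A T), g Z =
      ∑ Y ∈ arrFlats A, (g (cylinder Y) + ∑ Z ∈ T.image (graphOver Y), g Z) := by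
  have h1 : arrFlats (extArr A T) =
      (arrFlats A).biUnion fun Y => insert (cylinder Y) (T.image (graphOver Y)) := by
    ext Z
    rw [mem_arrFlats_extArr hT]
    simp [eq_comm]
  rw [h1, Finset.sum_biUnion]
  · refine Finset.sum_congr rfl fun Y _ => Finset.sum_insert fun h => ?_
    obtain ⟨φ, _, h⟩ := Finset.mem_image.1 h
    exact not_cylinder_le_graphOver Y Y φ h.ge
  · have h2 : ∀ Y, ∀ Z ∈ insert (cylinder Y) (T.image (graphOver Y)), Z.map (tailMap n) = Y := by
      intro Y Z hZ
      rcases Finset.mem_insert.1 hZ with rfl | hZ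
      · exact map_cylinder Y
      · obtain ⟨φ, _, rfl⟩ := Finset.mem_image.1 hZ
        exact map_graphOver Y φ
    intro Y _ Y' _ hne
    exact Finset.disjoint_left.2 fun Z hZ hZ' => hne ((h2 Y Z hZ).symm.trans (h2 Y' Z hZ'))

theorem inf_extArr (hT : ∀ φ ∈ T, ∀ ψ ∈ T, φ ≠ ψ → LinearMap.ker (φ - ψ) ∈ A)
    {φ : (Fin n → ℝ) →ₗ[ℝ] ℝ} (hφ : φ ∈ T) :
    (extArr A T).inf id = graphOver (A.inf id) φ := by
  have h1 := inf_le_of_mem_arrFlats (graphOver_mem_arrFlats (inf_mem_arrFlats A) hφ)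
  obtain ⟨Y, hY, h | ⟨ψ, hψ, h⟩⟩ := (mem_arrFlats_extArr hT).1 (inf_mem_arrFlats (extArr A T))
  · rw [h] at h1
    exact absurd h1 (not_cylinder_le_graphOver _ _ _)
  · rw [h] at h1 ⊢
    obtain ⟨h2, h3⟩ := graphOver_le_graphOver.1 h1
    exact graphOver_eq_graphOver.2 ⟨le_antisymm h2 (inf_le_of_mem_arrFlats hY), h3⟩

end Extension

/-! ### Fiber-type data and its inductive step. -/

section FiberType

variable {n : ℕ}

open Classical in
theorem Finset.card_image_eq_card_image_of_iff {α β γ : Type*} {s : Finset α} {f : α → β}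
    {g : α → γ} (h : ∀ a ∈ s, ∀ b ∈ s, f a = f b ↔ g a = g b) :
    (s.image f).card = (s.image g).card := by
  induction s using Finset.induction_on with
  | empty => rfl
  | insert a s ha ih =>
    have ih := ih fun x hx y hy => h x (mem_insert_of_mem hx) y (mem_insert_of_mem hy)
    have h1 : f a ∈ s.image f ↔ g a ∈ s.image g := by
      simp only [mem_image]
      exact exists_congr fun b => and_congr_right fun hb =>
        h b (mem_insert_of_mem hb) a (mem_insert_self a s)
    rw [image_insert, image_insert]
    by_cases h2 : f a ∈ s.image f
    · rw [insert_eq_of_mem h2, insert_eq_of_mem (h1.1 h2), ih]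
    · rw [card_insert_of_notMem h2, card_insert_of_notMem (mt h1.2 h2), ih]

open Classical in
/-- The pair `(A, T)` of an arrangement and a set of functionals on `ℝⁿ` is such that `extArr A T`
fibers over `A`. Every flat of dimension `d` lies below exactly `c d` flats of the form
`graphOver Y φ`, and `f d` is the value `μ(⊥, Y)` at each flat `Y` of dimension `d`. -/
structure IsFiberData (A : Finset (Submodule ℝ (Fin n → ℝ)))
    (T : Finset ((Fin n → ℝ) →ₗ[ℝ] ℝ)) (c : ℕ → ℕ) (f : ℕ → ℤ) : Prop where
  nonempty : T.Nonempty
  ker_sub_mem : ∀ φ ∈ T, ∀ ψ ∈ T, φ ≠ ψ → LinearMap.ker (φ - ψ) ∈ A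
  card_image : ∀ Y ∈ arrFlats A, (T.image (graphOver Y)).card = c (Module.finrank ℝ Y)
  sum_le : ∀ Y ∈ arrFlats A,
    ∑ Z ∈ arrFlats A with Z ≤ Y, f (Module.finrank ℝ Z) = if Y = A.inf id then 1 else 0

namespace IsFiberData

variable {A : Finset (Submodule ℝ (Fin n → ℝ))} {T : Finset ((Fin n → ℝ) →ₗ[ℝ] ℝ)}
  {c : ℕ → ℕ} {f : ℕ → ℤ}

theorem card_pos (h : IsFiberData A T c f) {Y : Submodule ℝ (Fin n → ℝ)} (hY : Y ∈ arrFlats A) :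
    0 < c (Module.finrank ℝ Y) := by
  rw [← h.card_image Y hY, Finset.card_pos]
  exact h.nonempty.image _

open Classical in
theorem sum_image_graphOver (h : IsFiberData A T c f) {M : Type*} [AddCommMonoid M]
    {Y : Submodule ℝ (Fin n → ℝ)} (hY : Y ∈ arrFlats A) {g : Submodule ℝ (Fin (n + 1) → ℝ) → M}
    {m : M} (hg : ∀ φ ∈ T, g (graphOver Y φ) = m) :
    ∑ Z ∈ T.image (graphOver Y), g Z = c (Module.finrank ℝ Y) • m := by
  rw [Finset.sum_congr rfl (g := fun _ => m), Finset.sum_const, h.card_image Y hY]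
  intro Z hZ
  obtain ⟨φ, hφ, rfl⟩ := Finset.mem_image.1 hZ
  exact hg φ hφ

-- Below a cylinder, each base flat of dimension d contributes f(d+1) from its cylinder and f(d)
-- from each of its c(d) graphs, and these cancel. Below a graph, only graphs of the same functional
-- occur, so the recursion is that of the base.
open Classical in
theorem sum_le_extArr (h : IsFiberData A T c f)
    (hf : ∀ d, 0 < c d → f (d + 1) = -(c d * f d)) {X : Submodule ℝ (Fin (n + 1) → ℝ)}
    (hX : X ∈ arrFlats (extArr A T)) :
    ∑ Z ∈ arrFlats (extArr A T) with Z ≤ X, f (Module.finrank ℝ Z) =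
      if X = (extArr A T).inf id then 1 else 0 := by
  obtain ⟨Y, hY, rfl | ⟨φ, hφ, rfl⟩⟩ := (mem_arrFlats_extArr h.ker_sub_mem).1 hX
  · obtain ⟨φ, hφ⟩ := h.nonempty
    rw [inf_extArr h.ker_sub_mem hφ,
      if_neg fun h => not_cylinder_le_graphOver _ _ _ h.le, Finset.sum_filter,
      sum_arrFlats_extArr h.ker_sub_mem]
    refine Finset.sum_eq_zero fun Z hZ => ?_
    rw [h.sum_image_graphOver hZ
      (m := if Z ≤ Y then f (Module.finrank ℝ Z) else 0) fun ψ _ => by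
        rw [finrank_graphOver]; exact if_congr graphOver_le_cylinder rfl rfl,
      finrank_cylinder]
    by_cases hle : Z ≤ Y
    · rw [if_pos hle, if_pos (cylinder_le_cylinder.2 hle), hf _ (h.card_pos hZ), nsmul_eq_mul]
      ring
    · rw [if_neg hle, if_neg (mt cylinder_le_cylinder.1 hle), smul_zero, add_zero]
  · have h1 : (arrFlats (extArr A T)).filter (fun Z => Z ≤ graphOver Y φ) =
        ((arrFlats A).filter fun Z => Z ≤ Y).image fun Z => graphOver Z φ := by
      ext Z
      simp only [Finset.mem_filter, Finset.mem_image]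
      constructor
      · rintro ⟨hZ, hle⟩
        obtain ⟨Z, hZ', rfl | ⟨ψ, hψ, rfl⟩⟩ := (mem_arrFlats_extArr h.ker_sub_mem).1 hZ
        · exact absurd hle (not_cylinder_le_graphOver _ _ _)
        · obtain ⟨h2, h3⟩ := graphOver_le_graphOver.1 hle
          exact ⟨Z, ⟨hZ', h2⟩, graphOver_eq_graphOver.2 ⟨rfl, fun y hy => (h3 y hy).symm⟩⟩
      · rintro ⟨Z, ⟨hZ, hle⟩, rfl⟩
        exact ⟨graphOver_mem_arrFlats hZ hφ, graphOver_le_graphOver.2 ⟨hle, fun _ _ => rfl⟩⟩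
    rw [h1, Finset.sum_image fun Z _ Z' _ hZ => (graphOver_eq_graphOver.1 hZ).1]
    simp only [finrank_graphOver]
    rw [h.sum_le Y hY, inf_extArr h.ker_sub_mem hφ]
    exact if_congr ⟨fun h => by rw [h], fun h => (graphOver_eq_graphOver.1 h).1⟩ rfl rfl

-- On a cylinder x₀ is free, so the multiples u·x₀ are `U.card` new restrictions. On a graph of φ,
-- u·x₀ restricts to the pullback of uφ, which is already counted since T is stable under `U`.
open Classical in
theorem card_image_extArr (h : IsFiberData A T c f) {U : Finset ℝ}
    (hc : ∀ d, c (d + 1) = c d + U.card) (hU : ∀ u ∈ U, ∀ φ ∈ T, u • φ ∈ T) (hU0 : (0 : ℝ) ∉ U)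
    {X : Submodule ℝ (Fin (n + 1) → ℝ)} (hX : X ∈ arrFlats (extArr A T)) :
    ((T.image (fun φ => φ ∘ₗ tailMap n) ∪
      U.image fun u => u • (LinearMap.proj 0 : (Fin (n + 1) → ℝ) →ₗ[ℝ] ℝ)).image
        (graphOver X)).card = c (Module.finrank ℝ X) := by
  obtain ⟨Y, hY, rfl | ⟨φ, hφ, rfl⟩⟩ := (mem_arrFlats_extArr h.ker_sub_mem).1 hX
  · rw [Finset.image_union, Finset.image_image, Finset.image_image, Finset.card_union_of_disjoint,
      finrank_cylinder, hc, ← h.card_image Y hY]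
    · congr 1
      · refine Finset.card_image_eq_card_image_of_iff fun φ _ ψ _ => ?_
        simp only [Function.comp, graphOver_eq_graphOver, true_and]
        exact ⟨fun h y hy => by
          simpa [tailMap_cons] using h (Fin.cons 0 y) (cons_mem_cylinder.2 hy),
          fun h x hx => h _ hx⟩
      -- The vector (1, 0, …, 0) separates the multiples of x₀. It is also used below to separate
      -- them from the pulled-back functionals, which vanish there; hence 0 ∉ U.
      · refine Finset.card_image_of_injective _ fun u v huv => ?_
        simpa using (graphOver_eq_graphOver.1 huv).2 (Fin.cons 1 0)
          (cons_mem_cylinder.2 Y.zero_mem)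
    · refine Finset.disjoint_left.2 fun Z hZ hZ' => ?_
      obtain ⟨φ, _, rfl⟩ := Finset.mem_image.1 hZ
      obtain ⟨u, hu, huφ⟩ := Finset.mem_image.1 hZ'
      have h1 := (graphOver_eq_graphOver.1 huφ).2 (Fin.cons 1 0) (cons_mem_cylinder.2 Y.zero_mem)
      have h2 : u = 0 := by simpa [tailMap_cons] using h1
      exact hU0 (h2 ▸ hu)
  · rw [finrank_graphOver, ← h.card_image Y hY, Finset.image_union, Finset.image_image,
      Finset.image_image, Finset.union_eq_left.2]
    · refine Finset.card_image_eq_card_image_of_iff fun ψ _ χ _ => ?_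
      simp only [Function.comp, graphOver_eq_graphOver, true_and]
      exact ⟨fun h y hy => by
        simpa [tailMap_cons] using h (Fin.cons (φ y) y) (cons_mem_graphOver.2 ⟨hy, rfl⟩),
        fun h x hx => h _ (mem_graphOver.1 hx).1⟩
    · intro Z hZ
      obtain ⟨u, hu, rfl⟩ := Finset.mem_image.1 hZ
      refine Finset.mem_image.2 ⟨u • φ, hU u hu φ hφ, graphOver_eq_graphOver.2
        ⟨rfl, fun x hx => ?_⟩⟩
      simp [(mem_graphOver.1 hx).2]

theorem flatMu_botFlat (h : IsFiberData A T c f) (Y : arrFlats A) :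
    flatMu A (botFlat A) Y = f (Module.finrank ℝ (Y : Submodule ℝ (Fin n → ℝ))) :=
  flatMu_botFlat_eq (f := fun Y => f (Module.finrank ℝ Y)) h.sum_le Y

open Classical in
theorem extend (h : IsFiberData A T c f) (hf : ∀ d, 0 < c d → f (d + 1) = -(c d * f d))
    {U : Finset ℝ} (hc : ∀ d, c (d + 1) = c d + U.card) (hU : ∀ u ∈ U, ∀ φ ∈ T, u • φ ∈ T)
    (hU0 : (0 : ℝ) ∉ U) {T' : Finset ((Fin (n + 1) → ℝ) →ₗ[ℝ] ℝ)}
    (hT' : T' = T.image (fun φ => φ ∘ₗ tailMap n) ∪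
      U.image fun u => u • (LinearMap.proj 0 : (Fin (n + 1) → ℝ) →ₗ[ℝ] ℝ))
    (hker : ∀ φ ∈ T', ∀ ψ ∈ T', φ ≠ ψ → LinearMap.ker (φ - ψ) ∈ extArr A T) :
    IsFiberData (extArr A T) T' c f where
  nonempty := hT' ▸ (h.nonempty.image _).mono Finset.subset_union_left
  ker_sub_mem := hker
  card_image _ hX := by
    rw [hT']
    exact h.card_image_extArr hc hU hU0 hX
  sum_le _ hX := h.sum_le_extArr hf hX

theorem of_empty {T : Finset ((Fin n → ℝ) →ₗ[ℝ] ℝ)} {φ : (Fin n → ℝ) →ₗ[ℝ] ℝ} (hT : T = {φ})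
    (hc : c n = 1) (hf : f n = 1) : IsFiberData ∅ T c f := by
  have hflats : arrFlats (∅ : Finset (Submodule ℝ (Fin n → ℝ))) = {⊤} := by simp [arrFlats]
  subst hT
  refine ⟨Finset.singleton_nonempty φ, ?_, ?_, ?_⟩
  · simp
  · simp [hflats, hc]
  · simp [hflats, Finset.filter_singleton, hf]

end IsFiberData

end FiberType

/-! ### Weighted sums over flats. -/

section FlatSum

variable {n : ℕ} {R : Type*} [CommRing R]

/-- The sum of `|f d| * t ^ (n - d) * u d` over the flats of `A`, where `d` is the dimension of
the flat. -/
noncomputable def flatSum (A : Finset (Submodule ℝ (Fin n → ℝ))) (f : ℕ → ℤ) (t : R) (u : ℕ → R) :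
    R :=
  ∑ Y ∈ arrFlats A, (|f (Module.finrank ℝ Y)| : ℤ) * t ^ (n - Module.finrank ℝ Y) *
    u (Module.finrank ℝ Y)

variable {A : Finset (Submodule ℝ (Fin n → ℝ))} {T : Finset ((Fin n → ℝ) →ₗ[ℝ] ℝ)}
  {c : ℕ → ℕ} {f : ℕ → ℤ}

/-- A cylinder keeps the codimension and multiplies |μ| by c(d), giving u(d+1); each of the c(d)
graphs keeps |μ| and raises the codimension by one, giving t u(d). -/
theorem IsFiberData.flatSum_extArr (h : IsFiberData A T c f)
    (hf : ∀ d, 0 < c d → f (d + 1) = -(c d * f d)) (t : R) (u : ℕ → R) :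
    flatSum (extArr A T) f t u = flatSum A f t fun d => c d * (t * u d + u (d + 1)) := by
  rw [flatSum, sum_arrFlats_extArr h.ker_sub_mem, flatSum]
  refine Finset.sum_congr rfl fun Y hY => ?_
  rw [h.sum_image_graphOver hY (m := (|f (Module.finrank ℝ Y)| : ℤ) *
    t ^ (n + 1 - Module.finrank ℝ Y) * u (Module.finrank ℝ Y)) fun φ _ => by
      rw [finrank_graphOver], finrank_cylinder]
  have hle : Module.finrank ℝ Y ≤ n := by simpa using Y.finrank_le
  rw [hf _ (h.card_pos hY), abs_neg, abs_mul, Nat.abs_cast, Nat.add_sub_add_right,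
    Nat.sub_add_comm hle, nsmul_eq_mul]
  push_cast
  ring

theorem IsFiberData.primitiveEulerian_eq (h : IsFiberData A T c f) :
    primitiveEulerian A = flatSum A f (X - 1) fun _ => 1 := by
  rw [primitiveEulerian_eq_sum (f := fun Y => f (Module.finrank ℝ Y)) h.flatMu_botFlat, flatSum]
  refine Finset.sum_congr rfl fun Y _ => ?_
  have h1 := Y.finrank_quotient_add_finrank
  rw [Module.finrank_fin_fun] at h1
  rw [← Nat.eq_sub_of_add_eq h1, mul_one]
  simp

theorem map_flatSum {S : Type*} [CommRing S] (e : R →+* S) (t : R) (u : ℕ → R) :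
    e (flatSum A f t u) = flatSum A f (e t) fun d => e (u d) := by
  simp [flatSum]

theorem derivation_flatSum (D : Derivation R R[X] R[X]) (t : R) (u : ℕ → R[X]) :
    D (flatSum A f (C t) u) = flatSum A f (C t) fun d => D (u d) := by
  rw [flatSum, flatSum, map_sum]
  refine Finset.sum_congr rfl fun Y _ => ?_
  rw [← map_intCast (C : R →+* R[X]), ← map_pow, ← map_mul, ← smul_eq_C_mul, ← smul_eq_C_mul,
    D.map_smul]

theorem flatSum_const_mul (a t : R) (u : ℕ → R) :
    (flatSum A f t fun d => a * u d) = a * flatSum A f t u := by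
  rw [flatSum, flatSum, Finset.mul_sum]
  exact Finset.sum_congr rfl fun Y _ => by ring

end FlatSum

/-! ### The braid and type B arrangements as fiber-type towers. -/

section TypeAB

open Classical in
/-- The coordinate functionals of `ℝⁿ`. -/
noncomputable def coordForms (n : ℕ) : Finset ((Fin n → ℝ) →ₗ[ℝ] ℝ) :=
  Finset.univ.image fun i => LinearMap.proj i

open Classical in
/-- The coordinate functionals of `ℝⁿ`, their negatives, and zero. -/
noncomputable def signedCoordForms (n : ℕ) : Finset ((Fin n → ℝ) →ₗ[ℝ] ℝ) :=
  insert 0 (coordForms n ∪ (coordForms n).image fun φ => -φ)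

variable {n : ℕ}

theorem mem_braidArr {H : Submodule ℝ (Fin n → ℝ)} :
    H ∈ braidArr n ↔ ∃ i j, i < j ∧ hypEq i j = H := by
  simp [braidArr, ltPairs]

theorem mem_typeBArr {H : Submodule ℝ (Fin n → ℝ)} :
    H ∈ typeBArr n ↔ (∃ i j, i < j ∧ hypEq i j = H) ∨ (∃ i j, i < j ∧ hypNeg i j = H) ∨
      ∃ i, hypZero i = H := by
  simp [typeBArr, ltPairs]

theorem mem_coordForms {φ : (Fin n → ℝ) →ₗ[ℝ] ℝ} :
    φ ∈ coordForms n ↔ ∃ i, LinearMap.proj i = φ := by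
  simp [coordForms]

theorem mem_signedCoordForms {φ : (Fin n → ℝ) →ₗ[ℝ] ℝ} :
    φ ∈ signedCoordForms n ↔ φ = 0 ∨ (∃ i, LinearMap.proj i = φ) ∨
      ∃ i, -LinearMap.proj i = φ := by
  simp [signedCoordForms, mem_coordForms]

theorem hypEq_comm (i j : Fin n) : hypEq i j = hypEq j i :=
  SetLike.ext fun _ => eq_comm

theorem hypNeg_comm (i j : Fin n) : hypNeg i j = hypNeg j i :=
  SetLike.ext fun _ => ⟨fun h => eq_neg_of_add_eq_zero_right (add_eq_zero_iff_eq_neg.2 h),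
    fun h => eq_neg_of_add_eq_zero_right (add_eq_zero_iff_eq_neg.2 h)⟩

theorem hypNeg_self (i : Fin n) : hypNeg i i = hypZero i :=
  SetLike.ext fun _ => self_eq_neg

theorem dualGraph_proj (i : Fin n) : dualGraph (LinearMap.proj i) = hypEq 0 i.succ :=
  SetLike.ext fun _ => mem_dualGraph

theorem dualGraph_neg_proj (i : Fin n) : dualGraph (-LinearMap.proj i) = hypNeg 0 i.succ :=
  SetLike.ext fun _ => mem_dualGraph

theorem dualGraph_zero : dualGraph (0 : (Fin n → ℝ) →ₗ[ℝ] ℝ) = hypZero 0 :=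
  SetLike.ext fun _ => mem_dualGraph

theorem hypEq_mem_braidArr {i j : Fin n} (h : i ≠ j) : hypEq i j ∈ braidArr n := by
  rcases h.lt_or_gt with h | h
  · exact mem_braidArr.2 ⟨i, j, h, rfl⟩
  · exact mem_braidArr.2 ⟨j, i, h, hypEq_comm j i⟩

theorem hypEq_mem_typeBArr {i j : Fin n} (h : i ≠ j) : hypEq i j ∈ typeBArr n :=
  mem_typeBArr.2 (Or.inl (mem_braidArr.1 (hypEq_mem_braidArr h)))

theorem hypZero_mem_typeBArr (i : Fin n) : hypZero i ∈ typeBArr n :=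
  mem_typeBArr.2 (Or.inr (Or.inr ⟨i, rfl⟩))

theorem hypNeg_mem_typeBArr (i j : Fin n) : hypNeg i j ∈ typeBArr n := by
  rcases lt_trichotomy i j with h | rfl | h
  · exact mem_typeBArr.2 (Or.inr (Or.inl ⟨i, j, h, rfl⟩))
  · rw [hypNeg_self]
    exact hypZero_mem_typeBArr i
  · exact mem_typeBArr.2 (Or.inr (Or.inl ⟨j, i, h, hypNeg_comm j i⟩))

theorem extArr_braidArr (n : ℕ) : extArr (braidArr n) (coordForms n) = braidArr (n + 1) := by
  ext H
  simp only [extArr, Finset.mem_union, Finset.mem_image, mem_braidArr, mem_coordForms,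
    Fin.exists_fin_succ, Fin.succ_lt_succ_iff, Fin.succ_pos, Fin.not_lt_zero,
    true_and, false_and, false_or]
  constructor
  · rintro (⟨_, ⟨i, j, h, rfl⟩, rfl⟩ | ⟨_, ⟨i, rfl⟩, rfl⟩)
    · exact Or.inr ⟨i, j, h, rfl⟩
    · exact Or.inl ⟨i, (dualGraph_proj i).symm⟩
  · rintro (⟨i, rfl⟩ | ⟨i, j, h, rfl⟩)
    · exact Or.inr ⟨_, ⟨i, rfl⟩, dualGraph_proj i⟩
    · exact Or.inl ⟨_, ⟨i, j, h, rfl⟩, rfl⟩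

theorem extArr_typeBArr (n : ℕ) :
    extArr (typeBArr n) (signedCoordForms n) = typeBArr (n + 1) := by
  ext H
  simp only [extArr, Finset.mem_union, Finset.mem_image]
  constructor
  · rintro (⟨_, h, rfl⟩ | ⟨_, h, rfl⟩)
    · rcases mem_typeBArr.1 h with ⟨i, j, hij, rfl⟩ | ⟨i, j, _, rfl⟩ | ⟨i, rfl⟩
      · exact hypEq_mem_typeBArr ((Fin.succ_injective n).ne hij.ne)
      · exact hypNeg_mem_typeBArr i.succ j.succ
      · exact hypZero_mem_typeBArr i.succ
    · rcases mem_signedCoordForms.1 h with rfl | ⟨i, rfl⟩ | ⟨i, rfl⟩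
      · rw [dualGraph_zero]
        exact hypZero_mem_typeBArr 0
      · rw [dualGraph_proj]
        exact hypEq_mem_typeBArr (Fin.succ_ne_zero i).symm
      · rw [dualGraph_neg_proj]
        exact hypNeg_mem_typeBArr 0 i.succ
  · simp only [mem_typeBArr, mem_signedCoordForms, Fin.exists_fin_succ, Fin.succ_lt_succ_iff,
      Fin.succ_pos, Fin.not_lt_zero, true_and, false_and, false_or]
    rintro ((⟨i, rfl⟩ | ⟨i, j, h, rfl⟩) | (⟨i, rfl⟩ | ⟨i, j, h, rfl⟩) | rfl | ⟨i, rfl⟩)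
    · exact Or.inr ⟨_, Or.inr (Or.inl ⟨i, rfl⟩), dualGraph_proj i⟩
    · exact Or.inl ⟨_, Or.inl ⟨i, j, h, rfl⟩, rfl⟩
    · exact Or.inr ⟨_, Or.inr (Or.inr ⟨i, rfl⟩), dualGraph_neg_proj i⟩
    · exact Or.inl ⟨_, Or.inr (Or.inl ⟨i, j, h, rfl⟩), rfl⟩
    · exact Or.inr ⟨_, Or.inl rfl, dualGraph_zero⟩
    · exact Or.inl ⟨_, Or.inr (Or.inr ⟨i, rfl⟩), rfl⟩

theorem neg_one_smul_form (φ : (Fin n → ℝ) →ₗ[ℝ] ℝ) : (-1 : ℝ) • φ = -φ := by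
  ext
  simp

open Classical in
theorem coordForms_succ (n : ℕ) :
    coordForms (n + 1) = (coordForms n).image (fun φ => φ ∘ₗ tailMap n) ∪
      ({1} : Finset ℝ).image fun u => u • (LinearMap.proj 0 : (Fin (n + 1) → ℝ) →ₗ[ℝ] ℝ) := by
  ext φ
  simp only [mem_coordForms, Finset.mem_union, Finset.mem_image, Finset.mem_singleton,
    Fin.exists_fin_succ, exists_eq_left, one_smul, exists_exists_eq_and]
  exact or_comm

open Classical in
theorem signedCoordForms_succ (n : ℕ) :
    signedCoordForms (n + 1) = (signedCoordForms n).image (fun φ => φ ∘ₗ tailMap n) ∪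
      ({1, -1} : Finset ℝ).image
        fun u => u • (LinearMap.proj 0 : (Fin (n + 1) → ℝ) →ₗ[ℝ] ℝ) := by
  ext φ
  simp only [mem_signedCoordForms, Finset.mem_union, Finset.mem_image, Finset.mem_insert,
    Finset.mem_singleton, Fin.exists_fin_succ, or_and_right, exists_or, exists_eq_left, one_smul,
    exists_exists_eq_and, neg_one_smul_form, LinearMap.zero_comp, LinearMap.neg_comp,
    eq_comm (a := φ)]
  have h1 : ∀ i : Fin n, LinearMap.proj i ∘ₗ tailMap n = LinearMap.proj i.succ := fun _ => rfl
  simp only [h1]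
  tauto

theorem ker_sub_mem_braidArr {φ ψ : (Fin n → ℝ) →ₗ[ℝ] ℝ} (hφ : φ ∈ coordForms n)
    (hψ : ψ ∈ coordForms n) (hne : φ ≠ ψ) : LinearMap.ker (φ - ψ) ∈ braidArr n := by
  obtain ⟨i, rfl⟩ := mem_coordForms.1 hφ
  obtain ⟨j, rfl⟩ := mem_coordForms.1 hψ
  convert hypEq_mem_braidArr (i := i) (j := j) (by rintro rfl; exact hne rfl) using 1
  ext x
  simp [hypEq, sub_eq_zero]

theorem ker_sub_mem_typeBArr {φ ψ : (Fin n → ℝ) →ₗ[ℝ] ℝ} (hφ : φ ∈ signedCoordForms n)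
    (hψ : ψ ∈ signedCoordForms n) (hne : φ ≠ ψ) : LinearMap.ker (φ - ψ) ∈ typeBArr n := by
  have hEq : ∀ i j : Fin n, i ≠ j → ∀ χ : (Fin n → ℝ) →ₗ[ℝ] ℝ,
      (∀ x, χ x = 0 ↔ x i = x j) → LinearMap.ker χ ∈ typeBArr n := fun i j h χ hχ => by
    convert hypEq_mem_typeBArr h using 1
    ext x
    exact hχ x
  have hNeg : ∀ i j : Fin n, ∀ χ : (Fin n → ℝ) →ₗ[ℝ] ℝ,
      (∀ x, χ x = 0 ↔ x i = -x j) → LinearMap.ker χ ∈ typeBArr n := fun i j χ hχ => by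
    convert hypNeg_mem_typeBArr i j using 1
    ext x
    exact hχ x
  have hZero : ∀ i : Fin n, ∀ χ : (Fin n → ℝ) →ₗ[ℝ] ℝ,
      (∀ x, χ x = 0 ↔ x i = 0) → LinearMap.ker χ ∈ typeBArr n := fun i χ hχ => by
    convert hypZero_mem_typeBArr i using 1
    ext x
    exact hχ x
  rcases mem_signedCoordForms.1 hφ with rfl | ⟨i, rfl⟩ | ⟨i, rfl⟩ <;>
    rcases mem_signedCoordForms.1 hψ with rfl | ⟨j, rfl⟩ | ⟨j, rfl⟩
  · exact absurd rfl hne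
  · exact hZero j _ fun x => by simp
  · exact hZero j _ fun x => by simp
  · exact hZero i _ fun x => by simp
  · exact hEq i j (by rintro rfl; exact hne rfl) _ fun x => by simp [sub_eq_zero]
  · exact hNeg i j _ fun x => by simp [add_eq_zero_iff_eq_neg]
  · exact hZero i _ fun x => by simp
  · exact hNeg i j _ fun x => by
      simp only [LinearMap.sub_apply, LinearMap.neg_apply, LinearMap.proj_apply]
      constructor <;> intro h <;> linarith
  · exact hEq i j (by rintro rfl; exact hne rfl) _ fun x => by
      simp only [LinearMap.sub_apply, LinearMap.neg_apply, LinearMap.proj_apply]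
      constructor <;> intro h <;> linarith

/-- The value `μ(⊥, Y)` at a flat `Y` of dimension `d` of a type B arrangement. -/
def typeBMu (d : ℕ) : ℤ := ∏ i ∈ Finset.range d, -(2 * i + 1 : ℤ)

/-- The value `μ(⊥, Y)` at a flat `Y` of dimension `d ≥ 1` of a braid arrangement. -/
def braidMu (d : ℕ) : ℤ := ∏ i ∈ Finset.range (d - 1), -(i + 1 : ℤ)

theorem typeBMu_succ (d : ℕ) : typeBMu (d + 1) = -((2 * d + 1 : ℕ) * typeBMu d) := by
  rw [typeBMu, Finset.prod_range_succ, typeBMu]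
  push_cast
  ring

/-- At d = 0 the recursion fails, since `braidMu 1 = 1`; the guard `0 < c d` in the extension lemmas
excludes this case. -/
theorem braidMu_succ (d : ℕ) (hd : 0 < d) : braidMu (d + 1) = -(d * braidMu d) := by
  obtain ⟨d, rfl⟩ := Nat.exists_eq_add_of_lt hd
  simp only [braidMu, zero_add, Nat.add_sub_cancel, Finset.prod_range_succ]
  push_cast
  ring

theorem typeBArr_zero : typeBArr 0 = ∅ := by
  simp [typeBArr, ltPairs]

theorem braidArr_one : braidArr 1 = ∅ := by
  simp [braidArr, ltPairs]

theorem isFiberData_typeBArr (n : ℕ) :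
    IsFiberData (typeBArr n) (signedCoordForms n) (fun d => 2 * d + 1) typeBMu := by
  induction n with
  | zero =>
    rw [typeBArr_zero]
    refine IsFiberData.of_empty (φ := 0) ?_ rfl rfl
    ext φ
    simp [mem_signedCoordForms]
  | succ n ih =>
    rw [← extArr_typeBArr]
    refine ih.extend (fun d _ => typeBMu_succ d) (U := {1, -1}) (fun d => ?_) ?_ (by norm_num)
      (signedCoordForms_succ n) fun φ hφ ψ hψ hne => ?_
    · rw [Finset.card_pair (by norm_num)]
      ring
    · simp only [Finset.mem_insert, Finset.mem_singleton, mem_signedCoordForms]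
      rintro u (rfl | rfl) φ (rfl | ⟨i, rfl⟩ | ⟨i, rfl⟩) <;>
        simp [neg_one_smul_form]
    · rw [extArr_typeBArr]
      exact ker_sub_mem_typeBArr hφ hψ hne

/-- The tower starts in ℝ¹ because ℝ⁰ has no coordinate functional, while the data require a
nonempty set. -/
theorem isFiberData_braidArr (n : ℕ) :
    IsFiberData (braidArr (n + 1)) (coordForms (n + 1)) (fun d => d) braidMu := by
  induction n with
  | zero =>
    rw [braidArr_one]
    refine IsFiberData.of_empty (φ := LinearMap.proj 0) ?_ rfl rfl
    ext φ
    simp [mem_coordForms, eq_comm]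
  | succ n ih =>
    rw [← extArr_braidArr]
    refine ih.extend braidMu_succ (U := {1}) (fun d => ?_) ?_ (by norm_num)
      (coordForms_succ (n + 1)) fun φ hφ ψ hψ hne => ?_
    · rw [Finset.card_singleton]
    · simp
    · rw [extArr_braidArr]
      exact ker_sub_mem_braidArr hφ hψ hne

end TypeAB

/-- Leibniz's rule for iterates, by Pascal's rule; antidiagonals avoid truncated subtraction in the
induction. -/
theorem Derivation.iterate_mul {R S : Type*} [CommRing R] [CommRing S] [Algebra R S]
    (D : Derivation R S S) (n : ℕ) (a b : S) :
    D^[n] (a * b) = ∑ k ∈ Finset.range (n + 1), (n.choose k : S) * (D^[n - k] a * D^[k] b) := by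
  rw [← Finset.Nat.sum_antidiagonal_eq_sum_range_succ
    (f := fun k m => (n.choose k : S) * (D^[m] a * D^[k] b))]
  induction n with
  | zero => simp
  | succ n ih =>
    rw [Finset.sum_antidiagonal_choose_succ_mul (fun k m => D^[m] a * D^[k] b),
      Function.iterate_succ_apply', ih, map_sum, ← Finset.sum_add_distrib]
    refine Finset.sum_congr rfl fun p hp => ?_
    rw [Nat.choose_symm_of_eq_add (Finset.HasAntidiagonal.mem_antidiagonal.1 hp).symm]
    simp only [Derivation.leibniz, Derivation.map_natCast, Function.iterate_succ_apply',
      smul_eq_mul, mul_zero, add_zero]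
    ring

/-! ### The generating derivation and the recurrence. -/

section Recurrence

/-- The derivation of `ℤ[X][Y]` with `Y ↦ Y ((X - 1) + Y²)`. -/
noncomputable def eulerianDer : Derivation ℤ[X] ℤ[X][X] ℤ[X][X] :=
  mkDerivation ℤ[X] (X * (C (X - 1) + X ^ 2))

/-- This is the weight change c(d)(t u(d) + u(d+1)) once m = 2d + 1, or twice it once m = 2d in the
braid case. -/
theorem eulerianDer_X_pow (m : ℕ) :
    eulerianDer (X ^ m) = (m : ℤ[X][X]) * (C (X - 1 : ℤ[X]) * X ^ m + X ^ (m + 2)) := by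
  rw [Derivation.leibniz_pow, eulerianDer, mkDerivation_X]
  generalize C (X - 1 : ℤ[X]) = t
  cases m with
  | zero => simp
  | succ m =>
    simp only [nsmul_eq_mul, smul_eq_mul, Nat.add_sub_cancel]
    push_cast
    ring

theorem flatSum_typeBArr (n : ℕ) :
    flatSum (typeBArr n) typeBMu (C (X - 1) : ℤ[X][X]) (fun d => X ^ (2 * d + 1)) =
      eulerianDer^[n] X := by
  induction n with
  | zero =>
    rw [typeBArr_zero]
    simp [flatSum, arrFlats, typeBMu]
  | succ n ih =>
    rw [← extArr_typeBArr,
      (isFiberData_typeBArr n).flatSum_extArr fun d _ => typeBMu_succ d,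
      Function.iterate_succ_apply', ← ih, derivation_flatSum]
    exact congrArg (flatSum _ _ _) (funext fun d => (eulerianDer_X_pow (2 * d + 1)).symm)

/-- On Y^(2d) the derivation produces the factor 2d where the arrangement has c(d) = d. Each step
thus costs a 2, the source of 2^k in the theorem. -/
theorem flatSum_braidArr (n : ℕ) :
    2 ^ n * flatSum (braidArr (n + 1)) braidMu (C (X - 1) : ℤ[X][X]) (fun d => X ^ (2 * d)) =
      eulerianDer^[n] (X ^ 2) := by
  induction n with
  | zero =>
    rw [zero_add, braidArr_one]
    simp [flatSum, arrFlats, braidMu]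
  | succ n ih =>
    have h : eulerianDer (2 ^ n) = 0 := by
      rw [← Nat.cast_ofNat, ← Nat.cast_pow, Derivation.map_natCast]
    rw [← extArr_braidArr, (isFiberData_braidArr n).flatSum_extArr braidMu_succ,
      Function.iterate_succ_apply', ← ih, pow_succ, mul_assoc, ← flatSum_const_mul,
      Derivation.leibniz, h, smul_zero, add_zero, smul_eq_mul, derivation_flatSum]
    refine congrArg (fun u => 2 ^ n * flatSum _ _ _ u) (funext fun d => ?_)
    rw [eulerianDer_X_pow]
    push_cast
    ring

theorem primitiveEulerian_typeBArr (n : ℕ) :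
    primitiveEulerian (typeBArr n) = (eulerianDer^[n] X).eval 1 := by
  rw [(isFiberData_typeBArr n).primitiveEulerian_eq, ← flatSum_typeBArr, ← coe_evalRingHom,
    map_flatSum]
  simp

theorem primitiveEulerian_braidArr (n : ℕ) :
    2 ^ n * primitiveEulerian (braidArr (n + 1)) = (eulerianDer^[n] (X ^ 2)).eval 1 := by
  rw [(isFiberData_braidArr n).primitiveEulerian_eq, ← flatSum_braidArr, ← coe_evalRingHom,
    map_mul, map_flatSum]
  simp

end Recurrence

theorem theoremt :
    primitiveEulerian (typeBArr 0) = 1 ∧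
    ∀ n : ℕ, 1 ≤ n →
      primitiveEulerian (typeBArr n) =
        X * primitiveEulerian (typeBArr (n - 1)) +
          ∑ k ∈ Finset.Icc 1 (n - 1),
            ((n - 1).choose k : ℤ[X]) * 2 ^ k *
              primitiveEulerian (typeBArr (n - 1 - k)) *
              primitiveEulerian (braidArr (k + 1)) := by
  refine ⟨by simp [primitiveEulerian_typeBArr], fun n hn => ?_⟩
  obtain ⟨n, rfl⟩ := Nat.exists_eq_add_of_le' hn
  have h1 : eulerianDer X = C (X - 1) * X + X * X ^ 2 := by
    rw [eulerianDer, mkDerivation_X]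
    ring
  -- The derivation is linear over ℤ[z], so z - 1 is a constant for it.
  have h2 : ∀ a, eulerianDer^[n] (C (X - 1) * a) = C (X - 1) * eulerianDer^[n] a := fun a => by
    rw [← smul_eq_C_mul, ← smul_eq_C_mul]
    exact (Function.Commute.iterate_left
      (f := eulerianDer) (g := fun a => (X - 1 : ℤ[X]) • a) (fun a => eulerianDer.map_smul _ a) n) a
  have h3 : ∀ a b, eulerianDer^[n] (a + b) = eulerianDer^[n] a + eulerianDer^[n] b :=
    iterate_map_add eulerianDer n
  rw [Nat.add_sub_cancel, primitiveEulerian_typeBArr (n + 1), Function.iterate_succ_apply, h1, h3,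
    h2, Derivation.iterate_mul, Finset.range_eq_Ico, Finset.sum_eq_sum_Ico_succ_bot n.succ_pos]
  simp only [eval_add, eval_mul, eval_C, eval_finsetSum, eval_natCast, Nat.choose_zero_right,
    Nat.sub_zero, Function.iterate_zero, id_eq, eval_pow, eval_X, ← primitiveEulerian_typeBArr,
    ← primitiveEulerian_braidArr]
  have h4 : Finset.Icc 1 n = Finset.Ico (0 + 1) n.succ := by ext; simp
  rw [h4, ← add_assoc]
  -- The Leibniz term k = 0 contributes one copy of the type B polynomial, which turns the
  -- coefficient z - 1 into z.
  refine congrArg₂ (· + ·) ?_ (Finset.sum_congr rfl fun k _ => ?_)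
  · generalize primitiveEulerian (typeBArr n) = p
    rw [Nat.cast_one]
    ring
  · generalize primitiveEulerian (typeBArr (n - k)) = p
    generalize primitiveEulerian (braidArr (k + 1)) = q
    ring
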